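/- For $n\in\mathbb N=\{0,1,2,\dots\}$ let $$\Delta_n=\Big\{(x_0,\dots,x_n)\in\mathbb R^{n+1} : x_k\ge 0 \text{ for all } k,\ \sum_{k=0}^n x_k=1\Big\}$$ with its Borel $\sigma$-algebra, write $[n]=\{0,\dots,n\}$, and let $\mathbb R_\#^{n+1}$ be the set of vectors in $\mathbb R^{n+1}$ with nonnegative entries that are not all zero. For $n\ge 1$ and $i\in[n]$ define, for $w=(w_0,\dots,w_n)\in\mathbb R^{n+1}$, $$d^n_i(w)=\begin{cases}(w_0,\dots,w_{i-2},\,w_{i-1}+w_i,\,w_{i+1},\dots,w_n) & \text{if } i>0,\\ (w_1,\dots,w_{n-1},\,w_n+w_0) & \text{if } i=0,\end{cases}$$ and for $n\ge 0$ and $j\in[n]$ let $$s^n_j(w)=(w_0,\dots,w_{j-1},\,0,\,w_j,\dots,w_n).$$ These maps restrict to maps $d^n_i:\Delta_n\to\Delta_{n-1}$ and $s^n_j:\Delta_n\to\Delta_{n+1}$, and to maps $d^n_i:\mathbb R_\#^{n+1}\to\mathbb R_\#^{n}$ and $s^n_j:\mathbb R_\#^{n+1}\to\mathbb R_\#^{n+2}$.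 For $\alpha\in\mathbb R_\#^{n+1}$ let $\pi(0)<\dots<\pi(m)$ be the indices $k$ with $\alpha_k>0$, and put $\tilde\alpha=(\alpha_{\pi(0)},\dots,\alpha_{\pi(m)})$. The Dirichlet measure $\mu_\alpha$ on $\Delta_n$ is defined, for Borel sets $A\subseteq\Delta_n$, by $$\mu_\alpha(A)=\int_{\tilde A}\frac{\Gamma\big(\sum_{k=0}^m\tilde\alpha_k\big)}{\prod_{k=0}^m\Gamma(\tilde\alpha_k)}\prod_{k=0}^m y_k^{\tilde\alpha_k-1}\,dy,$$ $$\tilde A=\big\{(x_{\pi(0)},\dots,x_{\pi(m)}) : x\in A,\ x_k=0\text{ whenever }\alpha_k=0\big\}\subseteq\Delta_m,$$ where $dy=dy_0\cdots dy_{m-1}$ is Lebesgue measure on $\Delta_m$ in the coordinates $y_0,\dots,y_{m-1}$, of total mass $1/m!$ (for $m=0$, the unit mass on the one-point space $\Delta_0$). So the coordinates with zero parameter are degenerate at zero. **Proposition.** Let $n\in\mathbb N$ and $\alpha\in\mathbb R_\#^{n+1}$. Then $\mu_\alpha$ is a probability measure, and for all $i,j\in[n]$, $$\mu_\alpha\circ(d^n_i)^{-1}=\mu_{d^n_i(\alpha)}\quad(\text{if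 } n\ge 1),\qquad \mu_\alpha\circ(s^n_j)^{-1}=\mu_{s^n_j(\alpha)}.$$ That is, $d^n_i:(\Delta_n,\mu_\alpha)\to(\Delta_{n-1},\mu_{d^n_i(\alpha)})$ and $s^n_j:(\Delta_n,\mu_\alpha)\to(\Delta_{n+1},\mu_{s^n_j(\alpha)})$ are measurable, measure-preserving maps of probability spaces. -/

import Mathlib

open MeasureTheory
open scoped BigOperators

namespace DirichletSimplex

/-- The standard `n`-simplex, a subspace of `ℝ^{n+1}`, with its Borel σ-algebra. -/
abbrev Simplex (n : ℕ) : Type := stdSimplex ℝ (Fin (n + 1))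

/-- Vectors with nonnegative entries, at least one of which is positive. -/
def RSharp (n : ℕ) : Set (Fin n → ℝ) :=
  {x | (∀ i, 0 ≤ x i) ∧ ∃ i, 0 < x i}

/-! ### Face and degeneracy maps on vectors -/

/-- The face map on vectors `(w_0, …, w_{n+1})`. For `i > 0` the coordinates `i - 1` and `i` are
merged, the sum standing in place `i - 1`; for `i = 0` the first coordinate is added to the
last one. -/
def face {n : ℕ} (i : Fin (n + 2)) (w : Fin (n + 2) → ℝ) : Fin (n + 1) → ℝ := fun k =>
  if i = 0 then
    if k = Fin.last n then w (Fin.last (n + 1)) + w 0 else w k.succ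
  else if (k : ℕ) + 1 < i then w k.castSucc
  else if (k : ℕ) + 1 = i then w k.castSucc + w k.succ
  else w k.succ

/-- The degeneracy map on vectors `(w_0, …, w_n)`: a coordinate `0` is inserted in place `j`. -/
def degen {n : ℕ} (j : Fin (n + 1)) (w : Fin (n + 1) → ℝ) : Fin (n + 2) → ℝ :=
  Fin.insertNth (α := fun _ => ℝ) j.castSucc (0 : ℝ) w

theorem face_eq_sum {n : ℕ} (i : Fin (n + 2)) (w : Fin (n + 2) → ℝ) :
    ∑ k, face i w k = ∑ k, w k := by
  rcases Fin.eq_zero_or_eq_succ i with rfl | ⟨j, rfl⟩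
  · rw [Fin.sum_univ_succ w, Fin.sum_univ_castSucc, Fin.sum_univ_castSucc (fun k => w k.succ)]
    have h : ∀ k : Fin n, k.castSucc ≠ Fin.last n := fun k => (Fin.castSucc_lt_last k).ne
    simp only [face, if_true, h, if_false, Fin.succ_last]
    ring
  · have h : ∀ k : Fin (n + 1), face j.succ w k
        = w (j.succ.succAbove k) + if k = j then w j.succ else 0 := by
      intro k
      have hj : j.succ ≠ 0 := Fin.succ_ne_zero j
      rcases lt_trichotomy k j with hk | hk | hk
      · have h1 : (k : ℕ) + 1 < (j.succ : Fin (n + 2)) := by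
          simp only [Fin.val_succ]; exact Nat.succ_lt_succ hk
        have h2 : k.castSucc < j.succ := by
          rw [Fin.lt_def]; simp only [Fin.val_castSucc, Fin.val_succ]
          have := Fin.lt_def.1 hk; omega
        simp only [face, hj, if_false, h1, if_true, hk.ne, add_zero,
          Fin.succAbove_of_castSucc_lt _ _ h2]
      · subst hk
        simp [face]
      · have h3 := Fin.lt_def.1 hk
        have h1 : ¬ (k : ℕ) + 1 < (j.succ : Fin (n + 2)) := by
          simp only [Fin.val_succ]; omega
        have h1' : ¬ (k : ℕ) + 1 = (j.succ : Fin (n + 2)) := by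
          simp only [Fin.val_succ]; omega
        have h2 : j.succ ≤ k.castSucc := by
          rw [Fin.le_def]; simp only [Fin.val_castSucc, Fin.val_succ]; omega
        simp only [face, hj, if_false, h1, h1', hk.ne', add_zero,
          Fin.succAbove_of_le_castSucc _ _ h2]
    rw [Finset.sum_congr rfl (fun k _ => h k), Finset.sum_add_distrib,
      Fin.sum_univ_succAbove w j.succ]
    simp [add_comm]

theorem face_nonneg {n : ℕ} (i : Fin (n + 2)) {w : Fin (n + 2) → ℝ} (hw : ∀ k, 0 ≤ w k)
    (k : Fin (n + 1)) : 0 ≤ face i w k := by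
  unfold face
  split_ifs <;> first | exact hw _ | exact add_nonneg (hw _) (hw _)

theorem degen_sum {n : ℕ} (j : Fin (n + 1)) (w : Fin (n + 1) → ℝ) :
    ∑ k, degen j w k = ∑ k, w k := by
  simp [degen, Fin.sum_univ_succAbove _ j.castSucc]

theorem degen_nonneg {n : ℕ} (j : Fin (n + 1)) {w : Fin (n + 1) → ℝ} (hw : ∀ k, 0 ≤ w k)
    (k : Fin (n + 2)) : 0 ≤ degen j w k := by
  unfold degen
  rcases Fin.eq_self_or_eq_succAbove j.castSucc k with rfl | ⟨l, rfl⟩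
  · simp
  · simpa using hw l

theorem mem_RSharp_iff {n : ℕ} {x : Fin n → ℝ} :
    x ∈ RSharp n ↔ (∀ i, 0 ≤ x i) ∧ 0 < ∑ i, x i := by
  refine and_congr_right fun h => ?_
  rw [Finset.sum_pos_iff_of_nonneg (fun i _ => h i)]
  simp

theorem face_mem {n : ℕ} (i : Fin (n + 2)) {α : Fin (n + 2) → ℝ} (hα : α ∈ RSharp (n + 2)) :
    face i α ∈ RSharp (n + 1) := by
  rw [mem_RSharp_iff] at hα ⊢
  exact ⟨face_nonneg i hα.1, by rw [face_eq_sum]; exact hα.2⟩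

theorem degen_mem {n : ℕ} (j : Fin (n + 1)) {α : Fin (n + 1) → ℝ} (hα : α ∈ RSharp (n + 1)) :
    degen j α ∈ RSharp (n + 2) := by
  rw [mem_RSharp_iff] at hα ⊢
  exact ⟨degen_nonneg j hα.1, by rw [degen_sum]; exact hα.2⟩

/-- The face map `Δ_{n+1} → Δ_n`. -/
def faceMap {n : ℕ} (i : Fin (n + 2)) (w : Simplex (n + 1)) : Simplex n :=
  ⟨face i w.1, face_nonneg i w.2.1, (face_eq_sum i w.1).trans w.2.2⟩

/-- The degeneracy map `Δ_n → Δ_{n+1}`. -/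
def degenMap {n : ℕ} (j : Fin (n + 1)) (w : Simplex n) : Simplex (n + 1) :=
  ⟨degen j w.1, degen_nonneg j w.2.1, (degen_sum j w.1).trans w.2.2⟩

/-! ### The Dirichlet measures -/

/-- The chart of `Δ_m` given by the coordinates `x_0, …, x_{m-1}`. -/
def chart (m : ℕ) (x : Simplex m) : Fin m → ℝ := fun i => x.1 i.castSucc

/-- The chart is a measurable embedding, so that pulling a measure back along it is meaningful. -/
theorem measurableEmbedding_chart (m : ℕ) : MeasurableEmbedding (chart m) := by
  have hc : Continuous (chart m) :=
    continuous_pi fun i => (continuous_apply _).comp continuous_subtype_val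
  have hi : Function.Injective (chart m) := by
    intro x y h
    have h' : ∀ i : Fin m, x.1 i.castSucc = y.1 i.castSucc := fun i => congrFun h i
    apply Subtype.ext
    funext k
    refine Fin.lastCases ?_ h' k
    have hx := x.2.2
    have hy := y.2.2
    rw [Fin.sum_univ_castSucc] at hx hy
    rw [Finset.sum_congr rfl (fun i _ => h' i)] at hx
    linarith
  exact (hc.isClosedEmbedding hi).measurableEmbedding

/-- Lebesgue measure `dx` on `Δ_m`, i.e. `dx_0 ⋯ dx_{m-1}` in the chart above;
its total mass is `1 / m!`. On the point `Δ_0` it is the unit mass. -/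
noncomputable def simplexVolume (m : ℕ) : Measure (Simplex m) :=
  Measure.comap (chart m) volume

/-- The multivariate beta function `∏ Γ(α_i) / Γ(∑ α_i)`. -/
noncomputable def multiBeta {m : ℕ} (α : Fin (m + 1) → ℝ) : ℝ :=
  (∏ i, Real.Gamma (α i)) / Real.Gamma (∑ i, α i)

/-- The Dirichlet density with positive parameters `α_0, …, α_m`. -/
noncomputable def dirichletPDF {m : ℕ} (α : Fin (m + 1) → ℝ) (x : Simplex m) : ℝ :=
  (∏ i, x.1 i ^ (α i - 1)) / multiBeta α

/-- The set of indices of positive coordinates. -/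
noncomputable def posIndices {n : ℕ} (α : Fin n → ℝ) : Finset (Fin n) :=
  Finset.univ.filter fun i => 0 < α i

theorem card_posIndices {n : ℕ} {α : Fin n → ℝ} (hα : α ∈ RSharp n) :
    (posIndices α).card = ((posIndices α).card - 1) + 1 := by
  obtain ⟨i, hi⟩ := hα.2
  have : 0 < (posIndices α).card :=
    Finset.card_pos.2 ⟨i, Finset.mem_filter.2 ⟨Finset.mem_univ _, hi⟩⟩
  omega

/-- The increasing enumeration `π : {0, …, m} → {0, …, n}` of the indices of positive
coordinates, where `m + 1` is their number. -/
noncomputable def posEnum {n : ℕ} (α : Fin n → ℝ) (hα : α ∈ RSharp n) :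
    Fin ((posIndices α).card - 1 + 1) ↪o Fin n :=
  (posIndices α).orderEmbOfFin (card_posIndices hα)

/-- The Dirichlet measure on `Δ_n` with parameter `α`. It lives on the face
`{x | x_j = 0 whenever α_j = 0}`, which is identified with `Δ_m` through `π`
(`stdSimplex.map π y` has the coordinate `y_k` in place `π k`, and `0` in the other places), and
there it has the Dirichlet density with parameter `(α_{π 0}, …, α_{π m})` with respect to
Lebesgue measure on `Δ_m`. -/
noncomputable def dirichletMeasure {n : ℕ} (α : Fin (n + 1) → ℝ) (hα : α ∈ RSharp (n + 1)) :
    Measure (Simplex n) :=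
  Measure.map (stdSimplex.map (posEnum α hα))
    ((simplexVolume ((posIndices α).card - 1)).withDensity fun y =>
      ENNReal.ofReal (dirichletPDF (α ∘ posEnum α hα) y))

end DirichletSimplex

namespace DirichletSimplex

open ProbabilityTheory ENNReal

/-! ### Integration over finite products -/

/-! The Dirichlet law is the law of `G / ∑ G`, where the `G i` are independent gamma variables of
shapes `α i` and rate one, with `G i = 0` when `α i = 0`. Face and degeneracy maps both sum
coordinates over the fibres of a map of indices. Such a map is linear and preserves the total, so it
commutes with normalization; on gamma vectors it adds independent variables in disjoint blocks,
which yields independent gamma variables with the parameters added in the same way. An empty block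
gives the unit mass at `0`, in accordance with parameter zero.

In polar coordinates over the simplex the joint gamma density splits into a function of the sum and
a function of the direction (`lintegral_pi_gammaLaw`). This gives both the Dirichlet law and the
additivity of gamma laws. `map_linearMap_pi_gammaLaw` carries additivity over to vectors.
`dirichletMeasure_eq_map_normalize` covers zero parameters, because the inclusion of a face is
itself induced by a map of indices. -/

theorem lintegral_fin_prod_eq_prod {n : ℕ} (f : Fin n → ℝ → ℝ≥0∞) (hf : ∀ i, Measurable (f i)) :
    ∫⁻ x : Fin n → ℝ, ∏ i, f i (x i) = ∏ i, ∫⁻ t, f i t := by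
  induction n with
  | zero => simp [volume_pi]
  | succ n ih =>
    have hm : Measurable fun y : Fin n → ℝ => ∏ i, f i.succ (y i) :=
      Finset.measurable_fun_prod _ fun i _ => (hf _).comp (measurable_pi_apply i)
    rw [← ((volume_preserving_piFinSuccAbove (fun _ : Fin (n + 1) => ℝ) 0).symm
      (MeasurableEquiv.piFinSuccAbove (fun _ => ℝ) 0)).lintegral_comp_emb
      (MeasurableEquiv.measurableEmbedding _)]
    simp_rw [MeasurableEquiv.piFinSuccAbove_symm_apply, Fin.insertNthEquiv, Equiv.coe_fn_mk,
      Fin.prod_univ_succ, Fin.insertNth_zero, Fin.cons_zero, Fin.cons_succ]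
    simp only [cast_eq]
    rw [Measure.volume_eq_prod,
      lintegral_prod_mul (hf 0).aemeasurable hm.aemeasurable, ih _ fun i => hf i.succ]

theorem pi_withDensity {n : ℕ} (f : Fin n → ℝ → ℝ≥0∞) (hf : ∀ i, Measurable (f i))
    [∀ i, SigmaFinite ((volume : Measure ℝ).withDensity (f i))] :
    Measure.pi (fun i => (volume : Measure ℝ).withDensity (f i)) =
      (volume : Measure (Fin n → ℝ)).withDensity fun x => ∏ i, f i (x i) := by
  refine Measure.pi_eq fun s hs => ?_
  rw [withDensity_apply _ (.univ_pi hs), ← lintegral_indicator (.univ_pi hs)]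
  -- The indicator of a box is a product of one-variable indicators, so it can be absorbed into the
  -- factors.
  have h : ∀ x : Fin n → ℝ, (Set.univ.pi s).indicator (fun x => ∏ i, f i (x i)) x =
      ∏ i, (s i).indicator (f i) (x i) := by
    intro x
    by_cases hx : x ∈ Set.univ.pi s
    · rw [Set.indicator_of_mem hx]
      exact Finset.prod_congr rfl fun i _ => (Set.indicator_of_mem (hx i trivial) _).symm
    · rw [Set.indicator_of_notMem hx]
      obtain ⟨i, hi⟩ : ∃ i, x i ∉ s i := by simpa [Set.mem_pi] using hx
      exact (Finset.prod_eq_zero (Finset.mem_univ i) (Set.indicator_of_notMem hi _)).symm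
  simp_rw [h]
  rw [lintegral_fin_prod_eq_prod _ fun i => (hf i).indicator (hs i)]
  exact Finset.prod_congr rfl fun i _ => by
    rw [withDensity_apply _ (hs i), lintegral_indicator (hs i)]

/-! ### Polar coordinates over the simplex -/

/-- With the first `m` coordinates fixed, passing from the last coordinate to the total is a
translation, so no Jacobian appears. -/
theorem lintegral_eq_lintegral_snoc {m : ℕ} {F : (Fin (m + 1) → ℝ) → ℝ≥0∞} (hF : Measurable F) :
    ∫⁻ x, F x =
      ∫⁻ s : ℝ, ∫⁻ y : Fin m → ℝ, F (Fin.snoc (α := fun _ => ℝ) y (s - ∑ i, y i)) := by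
  have hm : Measurable fun p : ℝ × (Fin m → ℝ) =>
      F (Fin.snoc (α := fun _ => ℝ) p.2 p.1) := by
    refine hF.comp (measurable_pi_lambda _ fun k => ?_)
    refine Fin.lastCases ?_ (fun i => ?_) k
    · simpa using measurable_fst
    · simp only [Fin.snoc_castSucc]
      fun_prop
  have hm' : Measurable fun p : ℝ × (Fin m → ℝ) =>
      F (Fin.snoc (α := fun _ => ℝ) p.2 (p.1 - ∑ i, p.2 i)) :=
    hm.comp (g := fun p : ℝ × (Fin m → ℝ) =>
      F (Fin.snoc (α := fun _ => ℝ) p.2 p.1)) (f := fun p : ℝ × (Fin m → ℝ) => (p.1 - ∑ i, p.2 i, p.2))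
      (by fun_prop)
  rw [← ((volume_preserving_piFinSuccAbove (fun _ : Fin (m + 1) => ℝ) (Fin.last m)).symm
      (MeasurableEquiv.piFinSuccAbove (fun _ => ℝ) (Fin.last m))).lintegral_comp_emb
      (MeasurableEquiv.measurableEmbedding _)]
  simp_rw [MeasurableEquiv.piFinSuccAbove_symm_apply, Fin.insertNthEquiv, Equiv.coe_fn_mk,
    Fin.insertNth_last']
  rw [Measure.volume_eq_prod, lintegral_prod_symm _ hm.aemeasurable]
  refine Eq.trans (lintegral_congr fun y => ?_)
    (lintegral_lintegral_swap hm'.aemeasurable).symm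
  exact (lintegral_sub_right_eq_self
    (fun t => F (Fin.snoc (α := fun _ => ℝ) y t)) (∑ i, y i)).symm

theorem snoc_chart {m : ℕ} (w : Simplex m) :
    Fin.snoc (α := fun _ => ℝ) (chart m w) (1 - ∑ i, chart m w i) = w.1 := by
  have h := w.2.2
  rw [Fin.sum_univ_castSucc] at h
  funext k
  refine Fin.lastCases ?_ (fun i => ?_) k
  · simp only [Fin.snoc_last, chart]
    linarith
  · simp [chart]

theorem mem_range_chart {m : ℕ} {y : Fin m → ℝ} :
    y ∈ Set.range (chart m) ↔
      ∀ k, 0 ≤ Fin.snoc (α := fun _ => ℝ) y (1 - ∑ i, y i) k := by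
  constructor
  · rintro ⟨w, rfl⟩
    rw [snoc_chart]
    exact w.2.1
  · intro h
    refine ⟨⟨_, h, by simp [Fin.sum_univ_castSucc]⟩, ?_⟩
    funext i
    simp [chart]

/-- For a function vanishing off the nonnegative orthant, Lebesgue integration decomposes into
the coordinate sum `s` and the direction in the simplex. -/
theorem lintegral_polar {m : ℕ} {F : (Fin (m + 1) → ℝ) → ℝ≥0∞} (hF : Measurable F)
    (h0 : ∀ x, (¬ ∀ k, 0 ≤ x k) → F x = 0) :
    ∫⁻ x, F x = ∫⁻ s in Set.Ioi (0 : ℝ),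
      ENNReal.ofReal (s ^ m) * ∫⁻ w, F (s • w.1) ∂(simplexVolume m) := by
  rw [lintegral_eq_lintegral_snoc hF, ← lintegral_indicator measurableSet_Ioi]
  refine lintegral_congr_ae ?_
  filter_upwards [compl_mem_ae_iff.2 (measure_singleton (μ := volume) (0 : ℝ))] with s hs
  rcases lt_or_gt_of_ne (show s ≠ 0 from hs) with hneg | hpos
  · rw [Set.indicator_of_notMem (by simpa using hneg.le)]
    -- The coordinates sum to `s < 0`, so one of them is negative.
    refine (lintegral_congr fun y => h0 _ fun h => ?_).trans lintegral_zero
    have h1 := Finset.sum_nonneg fun k (_ : k ∈ Finset.univ) => h k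
    simp [Fin.sum_univ_castSucc] at h1
    linarith
  rw [Set.indicator_of_mem (by simpa using hpos)]
  set H : (Fin m → ℝ) → ℝ≥0∞ := fun y => F (Fin.snoc (α := fun _ => ℝ) y (s - ∑ i, y i)) with hH
  have hsm : ∀ y : Fin m → ℝ,
      H (s • y) = F (s • Fin.snoc (α := fun _ => ℝ) y (1 - ∑ i, y i)) := by
    intro y
    simp only [hH]
    congr 1
    funext k
    refine Fin.lastCases ?_ (fun i => ?_) k
    · simp [← Finset.mul_sum, mul_sub]
    · simp
  -- Only `m` coordinates are free once the total is fixed, whence the factor `s ^ m`.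
  have hscale : ∫⁻ y, H (s • y) = ENNReal.ofReal (s ^ m)⁻¹ * ∫⁻ y, H y := by
    rw [← (measurableEmbedding_const_smul₀ hpos.ne').lintegral_map H,
      Measure.map_addHaar_smul volume hpos.ne', lintegral_smul_measure, Module.finrank_fin_fun, abs_of_pos (by positivity),
      smul_eq_mul]
  have hrange : ∫⁻ y, H (s • y) = ∫⁻ w, F (s • w.1) ∂(simplexVolume m) := by
    -- As `s > 0`, the integrand vanishes off the chart's image, so the integral over all of `ℝ^m`
    -- is one over the simplex.
    have hsupp : (fun y => H (s • y)).support ⊆ Set.range (chart m) := by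
      intro y hy
      rw [mem_range_chart]
      by_contra hneg
      refine hy ((hsm y).trans (h0 _ fun h => hneg fun k => ?_))
      exact nonneg_of_mul_nonneg_right (h k) hpos
    rw [← setLIntegral_eq_of_support_subset hsupp, ← (measurableEmbedding_chart m).map_comap, (measurableEmbedding_chart m).lintegral_map]
    refine lintegral_congr fun w => ?_
    rw [hsm, snoc_chart]
  rw [← hrange, hscale, ← mul_assoc, ← ENNReal.ofReal_mul (by positivity),
    mul_inv_cancel₀ (by positivity), ENNReal.ofReal_one, one_mul]

/-! ### Normalization of vectors -/

/-- The radial projection `x ↦ x / ∑ x` of `RSharp` to the simplex, extended by a constant. -/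
noncomputable def normalize {n : ℕ} (x : Fin (n + 1) → ℝ) : Simplex n :=
  open Classical in
  if h : x ∈ RSharp (n + 1) then
    ⟨fun k => x k / ∑ i, x i,
      fun k => div_nonneg (h.1 k) (Finset.sum_nonneg fun i _ => h.1 i), by
        rw [← Finset.sum_div, div_self (mem_RSharp_iff.1 h).2.ne']⟩
  else ⟨Pi.single 0 1, single_mem_stdSimplex ℝ 0⟩

theorem normalize_apply {n : ℕ} {x : Fin (n + 1) → ℝ} (h : x ∈ RSharp (n + 1))
    (k : Fin (n + 1)) : (normalize x).1 k = x k / ∑ i, x i := by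
  simp [normalize, h]

theorem measurableSet_RSharp (n : ℕ) : MeasurableSet (RSharp n) := by
  have h : RSharp n = (⋂ i, {x | 0 ≤ x i}) ∩ ⋃ i, {x | 0 < x i} := by
    ext x
    simp [RSharp]
  rw [h]
  exact (MeasurableSet.iInter fun i =>
      measurableSet_le measurable_const (measurable_pi_apply i)).inter
    (MeasurableSet.iUnion fun i => measurableSet_lt measurable_const (measurable_pi_apply i))

theorem measurable_normalize (n : ℕ) : Measurable (normalize (n := n)) := by
  classical
  refine (MeasurableEmbedding.subtype_coe
    (isClosed_stdSimplex ℝ (Fin (n + 1))).measurableSet).measurable_comp_iff.1 ?_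
  have h : (Subtype.val ∘ normalize (n := n)) = fun x =>
      if x ∈ RSharp (n + 1) then fun k => x k / ∑ i, x i else Pi.single 0 1 := by
    funext x
    by_cases hx : x ∈ RSharp (n + 1) <;> simp [normalize, hx]
  rw [h]
  exact Measurable.ite (measurableSet_RSharp _) (by fun_prop) measurable_const

theorem smul_mem_RSharp {n : ℕ} {s : ℝ} (hs : 0 < s) (w : Simplex n) :
    s • w.1 ∈ RSharp (n + 1) := by
  rw [mem_RSharp_iff]
  refine ⟨fun i => mul_nonneg hs.le (w.2.1 i), ?_⟩
  simp only [Pi.smul_apply, smul_eq_mul, ← Finset.mul_sum, w.2.2, mul_one, hs]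

theorem normalize_smul {n : ℕ} {s : ℝ} (hs : 0 < s) (w : Simplex n) :
    normalize (s • w.1) = w := by
  refine Subtype.ext (funext fun k => ?_)
  rw [normalize_apply (smul_mem_RSharp hs w)]
  simp only [Pi.smul_apply, smul_eq_mul, ← Finset.mul_sum, w.2.2, mul_one]
  exact mul_div_cancel_left₀ _ hs.ne'

/-! ### Independent gamma variables and the Dirichlet density -/

theorem measurable_gammaPDF (a r : ℝ) : Measurable (gammaPDF a r) :=
  (measurable_gammaPDFReal a r).ennreal_ofReal

theorem measurable_dirichletPDF {m : ℕ} (α : Fin (m + 1) → ℝ) :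
    Measurable (dirichletPDF α) := by
  have h (i : Fin (m + 1)) : Measurable fun x : Simplex m => x.1 i :=
    (measurable_pi_apply i).comp measurable_subtype_coe
  exact (Finset.measurable_fun_prod _ fun i _ => (h i).pow_const _).div_const _

/-- The coordinates of `s • w` sum to `s`, so the exponentials combine to `exp (-s)` and the powers
of `s` separate from those of `w`. The factor `Γ (∑ α)` in the Dirichlet constant cancels the one in
the gamma density. -/
theorem gammaPDF_prod_smul {m : ℕ} {α : Fin (m + 1) → ℝ} (hα : ∀ i, 0 < α i) {s : ℝ}
    (hs : 0 < s) (w : Simplex m) :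
    ENNReal.ofReal (s ^ m) * ∏ i, gammaPDF (α i) 1 ((s • w.1) i) =
      gammaPDF (∑ i, α i) 1 s * ENNReal.ofReal (dirichletPDF α w) := by
  have hw : ∀ i, 0 ≤ s * w.1 i := fun i => mul_nonneg hs.le (w.2.1 i)
  have hA : 0 < ∑ i, α i := Finset.sum_pos (fun i _ => hα i) Finset.univ_nonempty
  simp only [gammaPDF, Pi.smul_apply, smul_eq_mul]
  rw [← ENNReal.ofReal_prod_of_nonneg fun i _ => gammaPDFReal_nonneg (hα i) one_pos _,
    ← ENNReal.ofReal_mul (by positivity),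
    ← ENNReal.ofReal_mul (gammaPDFReal_nonneg hA one_pos _)]
  congr 1
  have hexp : ∏ i, Real.exp (-(s * w.1 i)) = Real.exp (-s) := by
    rw [← Real.exp_sum, Finset.sum_neg_distrib, ← Finset.mul_sum, w.2.2, mul_one]
  -- The Jacobian `s ^ m` compensates all but one of the `m + 1` shifts by `-1`.
  have hpow : s ^ m * ∏ i, s ^ (α i - 1) = s ^ (∑ i, α i - 1) := by
    rw [← Real.rpow_sum_of_pos hs, ← Real.rpow_natCast, ← Real.rpow_add hs]
    congr 1
    simp only [Finset.sum_sub_distrib, Finset.sum_const, Finset.card_univ, Fintype.card_fin,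
      nsmul_eq_mul, Nat.cast_add, Nat.cast_one, mul_one]
    ring
  simp only [gammaPDFReal, hw, hs.le, if_true, Real.one_rpow, one_mul,
    Finset.prod_mul_distrib, hexp, Real.mul_rpow hs.le (w.2.1 _), Finset.prod_div_distrib,
    Finset.prod_const_one, dirichletPDF, multiBeta]
  rw [← hpow, div_div_eq_mul_div]
  have hG := (Real.Gamma_pos_of_pos hA).ne'
  field_simp

/-- The Dirichlet law with positive parameters, given by its density on the simplex. -/
noncomputable def dirichletDensityMeasure {m : ℕ} (α : Fin (m + 1) → ℝ) : Measure (Simplex m) :=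
  (simplexVolume m).withDensity fun y => ENNReal.ofReal (dirichletPDF α y)

/-- The gamma law with shape `a` and rate `1`, the unit mass at `0` for `a ≤ 0`. -/
noncomputable def gammaLaw (a : ℝ) : Measure ℝ :=
  if 0 < a then gammaMeasure a 1 else Measure.dirac 0

theorem gammaLaw_of_pos {a : ℝ} (ha : 0 < a) :
    gammaLaw a = volume.withDensity (gammaPDF a 1) := if_pos ha

theorem gammaLaw_zero : gammaLaw 0 = Measure.dirac 0 := if_neg (lt_irrefl _)

instance isProbabilityMeasure_gammaLaw (a : ℝ) : IsProbabilityMeasure (gammaLaw a) := by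
  unfold gammaLaw
  split_ifs with h
  · exact isProbabilityMeasure_gammaMeasure h one_pos
  · infer_instance

/-- The sum of independent gamma variables is independent of their normalized vector, which has
the Dirichlet density. -/
theorem lintegral_pi_gammaLaw {m : ℕ} {α : Fin (m + 1) → ℝ} (hα : ∀ i, 0 < α i)
    {g : ℝ → ℝ≥0∞} (hg : Measurable g) {f : Simplex m → ℝ≥0∞} (hf : Measurable f) :
    ∫⁻ x, g (∑ i, x i) * f (normalize x) ∂(Measure.pi fun i => gammaLaw (α i)) =
      (∫⁻ s, g s ∂(gammaLaw (∑ i, α i))) * ∫⁻ w, f w ∂(dirichletDensityMeasure α) := by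
  have hA : 0 < ∑ i, α i := Finset.sum_pos (fun i _ => hα i) Finset.univ_nonempty
  have hpi : (Measure.pi fun i => gammaLaw (α i)) =
      volume.withDensity fun x => ∏ i, gammaPDF (α i) 1 (x i) := by
    have : ∀ i, SigmaFinite ((volume : Measure ℝ).withDensity (gammaPDF (α i) 1)) := fun i => by
      rw [← gammaLaw_of_pos (hα i)]
      infer_instance
    simp_rw [gammaLaw_of_pos (hα _)]
    exact pi_withDensity _ fun i => measurable_gammaPDF _ _
  have hP : Measurable fun x : Fin (m + 1) → ℝ => ∏ i, gammaPDF (α i) 1 (x i) :=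
    Finset.measurable_fun_prod _ fun i _ => (measurable_gammaPDF _ _).comp (measurable_pi_apply i)
  have hgf : Measurable fun x : Fin (m + 1) → ℝ => g (∑ i, x i) * f (normalize x) :=
    (hg.comp (by fun_prop)).mul (hf.comp (measurable_normalize m))
  have hD : Measurable fun w => ENNReal.ofReal (dirichletPDF α w) :=
    (measurable_dirichletPDF α).ennreal_ofReal
  rw [hpi, lintegral_withDensity_eq_lintegral_mul _ hP hgf, lintegral_polar (hP.mul hgf)]
  swap
  · intro x hx
    obtain ⟨k, hk⟩ := not_forall.1 hx
    refine mul_eq_zero_of_left (Finset.prod_eq_zero (Finset.mem_univ k) ?_) _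
    exact gammaPDF_of_neg (not_le.1 hk)
  rw [gammaLaw_of_pos hA, lintegral_withDensity_eq_lintegral_mul _ (measurable_gammaPDF _ _) hg,
    dirichletDensityMeasure, lintegral_withDensity_eq_lintegral_mul _ hD hf,
    ← lintegral_mul_const _ ((measurable_gammaPDF _ _).mul hg)]
  -- The gamma density vanishes on the negative axis but possibly not at `0`; that point is removed
  -- as a null set.
  refine Eq.trans ?_ (setLIntegral_eq_of_support_subset (s := Set.Ici 0) fun s hs => ?_)
  swap
  · by_contra h
    exact hs (mul_eq_zero_of_left
      (mul_eq_zero_of_left (gammaPDF_of_neg (not_le.1 h)) (g s)) _)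
  rw [setLIntegral_congr (Ioi_ae_eq_Ici (a := (0 : ℝ))).symm]
  refine setLIntegral_congr_fun measurableSet_Ioi fun s hs => ?_
  simp only [Pi.mul_apply]
  rw [← lintegral_const_mul' _ _ ENNReal.ofReal_ne_top, ← lintegral_const_mul _ (show Measurable fun w =>
    ENNReal.ofReal (dirichletPDF α w) * f w from hD.mul hf)]
  refine lintegral_congr fun w => ?_
  rw [← mul_assoc, gammaPDF_prod_smul hα hs, normalize_smul hs]
  have : ∑ i, (s • w.1) i = s := by
    simp only [Pi.smul_apply, smul_eq_mul, ← Finset.mul_sum, w.2.2, mul_one]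
  rw [this]
  ring

theorem map_normalize_pi_gammaLaw_of_pos {m : ℕ} {α : Fin (m + 1) → ℝ} (hα : ∀ i, 0 < α i) :
    (Measure.pi fun i => gammaLaw (α i)).map normalize = dirichletDensityMeasure α := by
  refine Measure.ext_of_lintegral _ fun f hf => ?_
  rw [lintegral_map hf (measurable_normalize m)]
  simpa using lintegral_pi_gammaLaw hα (measurable_const (a := (1 : ℝ≥0∞))) hf

theorem map_sum_pi_gammaLaw_of_pos {m : ℕ} {α : Fin (m + 1) → ℝ} (hα : ∀ i, 0 < α i) :
    (Measure.pi fun i => gammaLaw (α i)).map (fun x => ∑ i, x i) = gammaLaw (∑ i, α i) := by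
  -- The total mass needs no beta integral: this measure is the image of a probability measure.
  have : IsProbabilityMeasure (dirichletDensityMeasure α) := by
    rw [← map_normalize_pi_gammaLaw_of_pos hα]
    exact Measure.isProbabilityMeasure_map (measurable_normalize m).aemeasurable
  refine Measure.ext_of_lintegral _ fun f hf => ?_
  rw [lintegral_map hf (by fun_prop)]
  simpa using lintegral_pi_gammaLaw hα hf (measurable_const (a := (1 : ℝ≥0∞)))

/-- Shape zero gives the unit of convolution; for positive shapes this is the law of the sum in the
case of two variables. -/
theorem gammaLaw_add {a b : ℝ} (ha : 0 ≤ a) (hb : 0 ≤ b) :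
    gammaLaw (a + b) = gammaLaw a ∗ gammaLaw b := by
  rcases ha.eq_or_lt with rfl | ha
  · rw [gammaLaw_zero, Measure.dirac_zero_conv, zero_add]
  rcases hb.eq_or_lt with rfl | hb
  · rw [gammaLaw_zero, Measure.conv_dirac_zero, add_zero]
  have h := map_sum_pi_gammaLaw_of_pos (α := ![a, b]) (by simp [Fin.forall_fin_two, ha, hb])
  have h2 := (measurePreserving_piFinTwo fun i => gammaLaw (![a, b] i)).map_eq
  have hab : ∑ i, ![a, b] i = a + b := by simp
  rw [hab] at h
  simp only [Matrix.cons_val_zero, Matrix.cons_val_one] at h2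
  rw [← h, Measure.conv, ← h2, Measure.map_map (by fun_prop) (MeasurableEquiv.measurable _)]
  congr 1
  funext x
  exact Fin.sum_univ_two x

/-! ### Merging coordinates of gamma vectors -/

theorem charFunDual_gammaLaw_sum {ι : Type*} {α : ι → ℝ} (hα : ∀ i, 0 ≤ α i) (s : Finset ι)
    (L : StrongDual ℝ ℝ) :
    charFunDual (gammaLaw (∑ i ∈ s, α i)) L = ∏ i ∈ s, charFunDual (gammaLaw (α i)) L := by
  classical
  induction s using Finset.induction_on with
  | empty => simp [gammaLaw_zero, charFunDual_dirac]
  | insert i s hi ih =>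
    rw [Finset.sum_insert hi, Finset.prod_insert hi,
      gammaLaw_add (hα i) (Finset.sum_nonneg fun j _ => hα j), charFunDual_conv, ih]

/-- Summing the coordinates of a vector of independent gamma variables over the fibres of a map
gives a vector of independent gamma variables, with the parameters summed likewise. -/
theorem map_linearMap_pi_gammaLaw {ι κ : Type*} [Fintype ι] [Fintype κ] {α : ι → ℝ}
    (hα : ∀ i, 0 ≤ α i) (f : ι → κ) :
    (Measure.pi fun i => gammaLaw (α i)).map (FunOnFinite.linearMap ℝ ℝ f) =
      Measure.pi fun k => gammaLaw (FunOnFinite.linearMap ℝ ℝ f α k) := by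
  classical
  let T : (ι → ℝ) →L[ℝ] (κ → ℝ) :=
    ⟨FunOnFinite.linearMap ℝ ℝ f, FunOnFinite.continuous_linearMap ℝ ℝ f⟩
  have hT : (Measure.pi fun i => gammaLaw (α i)).map (FunOnFinite.linearMap ℝ ℝ f) =
    (Measure.pi fun i => gammaLaw (α i)).map T := rfl
  have : IsProbabilityMeasure ((Measure.pi fun i => gammaLaw (α i)).map T) :=
    Measure.isProbabilityMeasure_map T.continuous.measurable.aemeasurable
  rw [hT]
  -- Characteristic functionals determine finite measures and turn independence into products.
  refine Measure.ext_of_charFunDual (funext fun L => ?_)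
  rw [charFunDual_map, charFunDual_pi, charFunDual_pi]
  -- The functional `L ∘ T` acts on coordinate `i` as `L` does on coordinate `f i`, so the product
  -- regroups by the fibres of `f`.
  have hsingle : ∀ i, (L ∘SL T) ∘SL ContinuousLinearMap.single ℝ (fun _ => ℝ) i =
      L ∘SL ContinuousLinearMap.single ℝ (fun _ => ℝ) (f i) := by
    intro i
    ext
    simp [T, FunOnFinite.linearMap_piSingle]
  simp_rw [hsingle, FunOnFinite.linearMap_apply_apply, charFunDual_gammaLaw_sum hα]
  rw [← Finset.prod_fiberwise Finset.univ f]
  refine Finset.prod_congr rfl fun k _ => Finset.prod_congr rfl fun i hi => ?_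
  rw [(Finset.mem_filter.1 hi).2]

/-- Normalization divides by the total only on `RSharp`; one positive parameter already makes the
total almost surely positive. -/
theorem ae_mem_RSharp_pi_gammaLaw {n : ℕ} {α : Fin n → ℝ} (hα : α ∈ RSharp n) :
    ∀ᵐ x ∂(Measure.pi fun i => gammaLaw (α i)), x ∈ RSharp n := by
  have hev (i : Fin n) {p : ℝ → Prop} (h : ∀ᵐ t ∂gammaLaw (α i), p t) :
      ∀ᵐ x ∂(Measure.pi fun i => gammaLaw (α i)), p (x i) :=
    (Measure.quasiMeasurePreserving_eval (fun i => gammaLaw (α i)) i).ae h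
  have hpos (i : Fin n) (hi : 0 < α i) : ∀ᵐ t ∂gammaLaw (α i), 0 < t := by
    rw [gammaLaw_of_pos hi, ae_withDensity_iff (measurable_gammaPDF _ _)]
    filter_upwards [compl_mem_ae_iff.2 (measure_singleton (μ := volume) (0 : ℝ))] with t ht h
    refine lt_of_le_of_ne (not_lt.1 fun hneg => h (gammaPDF_of_neg hneg)) (Ne.symm ht)
  have hnonneg (i : Fin n) : ∀ᵐ t ∂gammaLaw (α i), 0 ≤ t := by
    rcases (hα.1 i).eq_or_lt with h | h
    · rw [← h, gammaLaw_zero, ae_dirac_iff measurableSet_Ici]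
    · exact (hpos i h).mono fun t => le_of_lt
  obtain ⟨i, hi⟩ := hα.2
  filter_upwards [ae_all_iff.2 fun i => hev i (hnonneg i), hev i (hpos i hi)] with x h1 h2
  exact ⟨h1, i, h2⟩

theorem sum_linearMap {ι κ : Type*} [Fintype ι] [Fintype κ] (f : ι → κ) (x : ι → ℝ) :
    ∑ k, FunOnFinite.linearMap ℝ ℝ f x k = ∑ i, x i := by
  classical
  simp_rw [FunOnFinite.linearMap_apply_apply]
  exact Finset.sum_fiberwise Finset.univ f x

theorem linearMap_mem_RSharp {n m : ℕ} {x : Fin n → ℝ} (hx : x ∈ RSharp n) (f : Fin n → Fin m) :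
    FunOnFinite.linearMap ℝ ℝ f x ∈ RSharp m := by
  rw [mem_RSharp_iff] at hx ⊢
  refine ⟨fun k => ?_, by rw [sum_linearMap]; exact hx.2⟩
  rw [FunOnFinite.linearMap_apply_apply]
  exact Finset.sum_nonneg fun i _ => hx.1 i

theorem normalize_linearMap {n m : ℕ} {x : Fin (n + 1) → ℝ} (hx : x ∈ RSharp (n + 1))
    (f : Fin (n + 1) → Fin (m + 1)) :
    normalize (FunOnFinite.linearMap ℝ ℝ f x) = stdSimplex.map f (normalize x) := by
  refine Subtype.ext (funext fun k => ?_)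
  rw [normalize_apply (linearMap_mem_RSharp hx f), sum_linearMap]
  refine Eq.trans ?_ (FunOnFinite.linearMap_apply_apply ℝ ℝ f (normalize x).1 k).symm
  rw [FunOnFinite.linearMap_apply_apply, Finset.sum_div]
  exact Finset.sum_congr rfl fun i _ => (normalize_apply hx i).symm

theorem measurable_map {n m : ℕ} (f : Fin (n + 1) → Fin (m + 1)) :
    Measurable (stdSimplex.map f : Simplex n → Simplex m) :=
  (stdSimplex.continuous_map f).measurable

theorem map_map_normalize_pi_gammaLaw {n m : ℕ} {α : Fin (n + 1) → ℝ} (hα : α ∈ RSharp (n + 1))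
    (f : Fin (n + 1) → Fin (m + 1)) :
    ((Measure.pi fun i => gammaLaw (α i)).map normalize).map (stdSimplex.map f) =
      (Measure.pi fun k => gammaLaw (FunOnFinite.linearMap ℝ ℝ f α k)).map normalize := by
  have hT : Measurable (FunOnFinite.linearMap ℝ ℝ f) :=
    (FunOnFinite.continuous_linearMap ℝ ℝ f).measurable
  rw [← map_linearMap_pi_gammaLaw hα.1, Measure.map_map (measurable_map f) (measurable_normalize n),
    Measure.map_map (measurable_normalize m) hT]
  refine Measure.map_congr ?_
  filter_upwards [ae_mem_RSharp_pi_gammaLaw hα] with x hx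
  exact (normalize_linearMap hx f).symm

/-! ### Dirichlet measures as laws of normalized gamma vectors -/

theorem posEnum_pos {n : ℕ} {α : Fin n → ℝ} (hα : α ∈ RSharp n)
    (k : Fin ((posIndices α).card - 1 + 1)) : 0 < α (posEnum α hα k) :=
  (Finset.mem_filter.1 (Finset.orderEmbOfFin_mem (posIndices α) (card_posIndices hα) k)).2

/-- Summing over the fibres of an injection is extension by zero, and the entries of `α` left out
are zero. -/
theorem linearMap_posEnum {n : ℕ} {α : Fin n → ℝ} (hα : α ∈ RSharp n) :
    FunOnFinite.linearMap ℝ ℝ (posEnum α hα) (α ∘ posEnum α hα) = α := by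
  funext i
  rw [FunOnFinite.linearMap_apply_apply]
  by_cases hi : 0 < α i
  · have hmem : i ∈ Set.range (posEnum α hα) := by
      unfold posEnum
      rw [Finset.range_orderEmbOfFin]
      exact Finset.mem_coe.2 (Finset.mem_filter.2 ⟨Finset.mem_univ _, hi⟩)
    obtain ⟨k, rfl⟩ := hmem
    have : (Finset.univ.filter fun l => posEnum α hα l = posEnum α hα k) = {k} := by
      ext l
      simp
    rw [this, Finset.sum_singleton, Function.comp_apply]
  · rw [Finset.filter_eq_empty_iff.2, Finset.sum_empty, le_antisymm (not_lt.1 hi) (hα.1 i)]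
    rintro k - rfl
    exact hi (posEnum_pos hα k)

/-- The positive case is transported along `posEnum`, which extends the gamma vector by zeros. -/
theorem dirichletMeasure_eq_map_normalize {n : ℕ} {α : Fin (n + 1) → ℝ}
    (hα : α ∈ RSharp (n + 1)) :
    dirichletMeasure α hα = (Measure.pi fun i => gammaLaw (α i)).map normalize := by
  have hpos : ∀ k, 0 < (α ∘ posEnum α hα) k := posEnum_pos hα
  have h : dirichletMeasure α hα =
      (dirichletDensityMeasure (α ∘ posEnum α hα)).map (stdSimplex.map (posEnum α hα)) := rfl
  rw [h, ← map_normalize_pi_gammaLaw_of_pos hpos,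
    map_map_normalize_pi_gammaLaw ⟨fun k => (hpos k).le, 0, hpos 0⟩, linearMap_posEnum]

theorem measurePreserving_map {n m : ℕ} {α : Fin (n + 1) → ℝ} (hα : α ∈ RSharp (n + 1))
    (f : Fin (n + 1) → Fin (m + 1)) {β : Fin (m + 1) → ℝ} (hβ : β ∈ RSharp (m + 1))
    (h : FunOnFinite.linearMap ℝ ℝ f α = β) :
    MeasurePreserving (stdSimplex.map f) (dirichletMeasure α hα) (dirichletMeasure β hβ) := by
  refine ⟨measurable_map f, ?_⟩
  rw [dirichletMeasure_eq_map_normalize, dirichletMeasure_eq_map_normalize,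
    map_map_normalize_pi_gammaLaw hα, h]

/-! ### Face and degeneracy maps -/

/-- The map of indices which the face map sums over: `i - 1` and `i` are identified, cyclically. -/
def faceIndex {n : ℕ} (i : Fin (n + 2)) : Fin (n + 2) → Fin (n + 1) :=
  Fin.cases (Fin.cons (Fin.last n) id) (fun j => j.predAbove) i

theorem degen_eq_linearMap {n : ℕ} (j : Fin (n + 1)) (w : Fin (n + 1) → ℝ) :
    degen j w = FunOnFinite.linearMap ℝ ℝ j.castSucc.succAbove w := by
  funext k
  rw [FunOnFinite.linearMap_apply_apply]
  rcases Fin.eq_self_or_eq_succAbove j.castSucc k with rfl | ⟨l, rfl⟩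
  · rw [Finset.filter_eq_empty_iff.2 fun l _ => Fin.succAbove_ne _ l]
    simp [degen]
  · simp [degen, Finset.sum_filter]

theorem face_eq_linearMap {n : ℕ} (i : Fin (n + 2)) (w : Fin (n + 2) → ℝ) :
    face i w = FunOnFinite.linearMap ℝ ℝ (faceIndex i) w := by
  funext k
  rw [FunOnFinite.linearMap_apply_apply]
  rcases Fin.eq_zero_or_eq_succ i with rfl | ⟨j, rfl⟩
  · rw [Finset.sum_filter, Fin.sum_univ_succ]
    simp only [faceIndex, Fin.cases_zero, Fin.cons_zero, Fin.cons_succ, id,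
      Finset.sum_ite_eq', Finset.mem_univ, if_true, face]
    by_cases hk : k = Fin.last n
    · subst hk
      simp [add_comm]
    · simp [hk, Ne.symm hk]
  · rw [Finset.sum_filter, Fin.sum_univ_succAbove _ j.succ]
    -- With `j.succ` set aside, the remaining indices correspond one to one to their images, so each
    -- fibre contributes one term; `j.succ` adds a second over `j`.
    have hj : ∀ l, j.predAbove (j.succ.succAbove l) = l := by
      intro l
      rcases lt_or_ge j l with h | h
      · rw [Fin.succAbove_of_lt_succ _ _ (Fin.succ_lt_succ_iff.2 h),
          Fin.predAbove_of_castSucc_lt _ _ (Fin.castSucc_lt_succ_iff.2 h.le), Fin.pred_succ]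
      · rw [Fin.succAbove_of_castSucc_lt _ _ (Fin.castSucc_lt_succ_iff.2 h),
          Fin.predAbove_of_le_castSucc _ _ (Fin.castSucc_le_castSucc_iff.2 h),
          Fin.castPred_castSucc]
    simp only [faceIndex, Fin.cases_succ, Fin.predAbove_succ_self, hj, Finset.sum_ite_eq',
      Finset.mem_univ, if_true, face, Fin.succ_ne_zero, if_false, Fin.val_succ]
    rcases lt_trichotomy k j with h | rfl | h
    · have h' := Fin.lt_def.1 h
      rw [if_pos (by omega), if_neg h.ne', zero_add,
        Fin.succAbove_of_castSucc_lt _ _ (Fin.castSucc_lt_succ_iff.2 h.le)]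
    · simp [add_comm]
    · have h' := Fin.lt_def.1 h
      rw [if_neg (by omega), if_neg (by omega), if_neg h.ne, zero_add,
        Fin.succAbove_of_lt_succ _ _ (Fin.succ_lt_succ_iff.2 h)]

theorem measurePreserving_faceMap {n : ℕ} {α : Fin (n + 2) → ℝ} (hα : α ∈ RSharp (n + 2))
    (i : Fin (n + 2)) :
    MeasurePreserving (faceMap i) (dirichletMeasure α hα)
      (dirichletMeasure (face i α) (face_mem i hα)) := by
  have h : faceMap i = stdSimplex.map (faceIndex i) :=
    funext fun w => Subtype.ext (face_eq_linearMap i w.1)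
  rw [h]
  exact measurePreserving_map hα _ _ (face_eq_linearMap i α).symm

theorem measurePreserving_degenMap {n : ℕ} {α : Fin (n + 1) → ℝ} (hα : α ∈ RSharp (n + 1))
    (j : Fin (n + 1)) :
    MeasurePreserving (degenMap j) (dirichletMeasure α hα)
      (dirichletMeasure (degen j α) (degen_mem j hα)) := by
  have h : degenMap j = stdSimplex.map j.castSucc.succAbove :=
    funext fun w => Subtype.ext (degen_eq_linearMap j w.1)
  rw [h]
  exact measurePreserving_map hα _ _ (degen_eq_linearMap j α).symm

theorem isProbabilityMeasure_dirichletMeasure {n : ℕ} {α : Fin (n + 1) → ℝ}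
    (hα : α ∈ RSharp (n + 1)) : IsProbabilityMeasure (dirichletMeasure α hα) := by
  rw [dirichletMeasure_eq_map_normalize]
  exact Measure.isProbabilityMeasure_map (measurable_normalize n).aemeasurable

end DirichletSimplex

theorem mainTheorem1 (n : ℕ) :
    (∀ (α : Fin (n + 1) → ℝ) (hα : α ∈ DirichletSimplex.RSharp (n + 1)),
      IsProbabilityMeasure (DirichletSimplex.dirichletMeasure α hα)) ∧
    (∀ (α : Fin (n + 2) → ℝ) (hα : α ∈ DirichletSimplex.RSharp (n + 2)) (i : Fin (n + 2)),
      MeasurePreserving (DirichletSimplex.faceMap i)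
        (DirichletSimplex.dirichletMeasure α hα)
        (DirichletSimplex.dirichletMeasure (DirichletSimplex.face i α)
          (DirichletSimplex.face_mem i hα))) ∧
    (∀ (α : Fin (n + 1) → ℝ) (hα : α ∈ DirichletSimplex.RSharp (n + 1)) (j : Fin (n + 1)),
      MeasurePreserving (DirichletSimplex.degenMap j)
        (DirichletSimplex.dirichletMeasure α hα)
        (DirichletSimplex.dirichletMeasure (DirichletSimplex.degen j α)
          (DirichletSimplex.degen_mem j hα))) :=
  ⟨fun _ hα => DirichletSimplex.isProbabilityMeasure_dirichletMeasure hα,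
    fun _ hα i => DirichletSimplex.measurePreserving_faceMap hα i,
    fun _ hα j => DirichletSimplex.measurePreserving_degenMap hα j⟩
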